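/- Let $K,\sigma>0$. There is an integer $n_0$, depending only on $K$ and $\sigma$, such that the following holds for every $n>n_0$. Let $X=[x_{ij}]\in\mathbb{R}^{n\times n}$ be a random symmetric matrix whose entries $x_{ij}$, $1\le i\le j\le n$, are independent random variables (not necessarily identically distributed) with $$\mathbb{E}[x_{ij}]=0,\qquad |x_{ij}|\le K \text{ almost surely},\qquad \mathbb{E}[x_{ij}^2]=\sigma_{ij}^2\le\sigma^2\qquad(1\le i\le j\le n),$$ where the $\sigma_{ij}$ may differ. Then $$\mathbb{P}\left[\|X\|_2>2\sigma\sqrt n+50\,K\,n^{1/3}\log n\right]<\frac1{n^{10}},$$ where $\|X\|_2$ is the spectral norm of $X$ (its operator norm with respect to the Euclidean norm) and $\log$ is the natural logarithm. -/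

import Mathlib

open MeasureTheory ProbabilityTheory

/-- The spectral norm of a real square matrix: its operator norm as a linear map of Euclidean
space `ℝⁿ` to itself. -/
noncomputable def spectralNorm₂ {n : ℕ} (A : Matrix (Fin n) (Fin n) ℝ) : ℝ :=
  ‖Matrix.toEuclideanCLM (n := Fin n) (𝕜 := ℝ) A‖

/-! This is a moment argument. For even `k`, `‖X‖ ^ k ≤ tr (X ^ k)`, so by Markov's inequality a
bound on `E tr (X ^ k)` is enough. The trace expands into closed walks of length `k`; by
independence and centring, a walk that uses some edge exactly once contributes zero.

The walks are not encoded and counted: they are summed one step at a time. A step to a new vertex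
weighs `A`, a second passage along the edge it created weighs `B`, where `A * B = σ ^ 2`, and any
other step weighs `K`. The number of second passages available is controlled by the potential `k ^
excess`: it does not grow at a new vertex, it drops by a factor `k` when a return had a choice, and
it grows by at most a factor `k` otherwise. Hence a step costs at most `n * A + B + k ^ 2 * K`
(`sum_stepWeight_mul_pow_excess_le`), and `E tr (X ^ k)` is at most `n` times the `k`-th power of
that (`integral_trace_pow_le`).

Taking `A = σ / √n` and `B = σ * √n` gives `2 * σ * √n + k ^ 2 * K`. With `k` of order `n ^ (1/6)`,
the correction `k ^ 2 * K` and the loss from taking a `k`-th root of `n ^ 11` both fit into the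
error term (`eventually_exists_exponent`). -/

/-! ### The potential that controls choices of the walk -/

section Excess

variable {V : Type*} [Fintype V] [DecidableEq V]

/-- The number of vertices joined to `v` by an edge of `S`. -/
def edgeDegree (S : Finset (Sym2 V)) (v : V) : ℕ := (Finset.univ.filter fun w => s(v, w) ∈ S).card

/-- The excess of a set `S` of edges as seen from `u`. It vanishes if `S` is a path that ends
in `u`, and it bounds how often a walk at `u` can have a choice between several edges of `S`. -/
def excess (S : Finset (Sym2 V)) (u : V) : ℕ :=
  ∑ v, (edgeDegree S v + (if v = u then 1 else 0) - 2)

/-- The edges traversed exactly once, after a step from `u` to `w`. -/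
def nextEdges (Vis : Finset V) (S : Finset (Sym2 V)) (u w : V) : Finset (Sym2 V) :=
  if w ∉ Vis then insert s(u, w) S else if s(u, w) ∈ S then S.erase s(u, w) else S

/-- The weight of a step from `u` to `w`: `A` when `w` is new, `B` along an edge of `S`,
`K` otherwise. -/
def stepWeight (A B K : ℝ) (Vis : Finset V) (S : Finset (Sym2 V)) (u w : V) : ℝ :=
  if w ∉ Vis then A else if s(u, w) ∈ S then B else K

lemma edgeDegree_insert {S : Finset (Sym2 V)} {u w : V} (huw : u ≠ w) (h : s(u, w) ∉ S) (v : V) :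
    edgeDegree (insert s(u, w) S) v
      = edgeDegree S v + (if v = u then 1 else 0) + (if v = w then 1 else 0) := by
  unfold edgeDegree
  have key : ∀ a b : V, a ≠ b → s(a, b) ∉ S →
      (Finset.univ.filter fun x => s(a, x) ∈ insert s(a, b) S).card
        = (Finset.univ.filter fun x => s(a, x) ∈ S).card + 1 := by
    intro a b hab hS
    rw [← Finset.card_insert_of_notMem (s := Finset.univ.filter fun x => s(a, x) ∈ S) (a := b)
      (by simpa using hS)]
    congr 1
    ext x
    simp
    grind
  by_cases h1 : v = u
  · subst h1
    rw [key v w huw h]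
    simp [huw]
  · by_cases h2 : v = w
    · subst h2
      rw [Sym2.eq_swap, key v u huw.symm (by rwa [Sym2.eq_swap])]
      simp [h1]
    · simp only [h1, h2, if_false, add_zero]
      congr 1
      ext x
      simp
      grind

/-- At `u` the new edge replaces the endpoint mark; at `w` the two together reach only the threshold
2. -/
lemma excess_insert_le {S : Finset (Sym2 V)} {u w : V} (huw : u ≠ w) (h : s(u, w) ∉ S)
    (hw : edgeDegree S w = 0) : excess (insert s(u, w) S) w ≤ excess S u := by
  refine Finset.sum_le_sum fun v _ => ?_
  rw [edgeDegree_insert huw h]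
  by_cases h2 : v = w
  · subst h2
    simp [hw, huw.symm]
  · simp [h2]

/-- At `w` the lost edge is offset by the endpoint mark, while `u` loses both, which lowers its term
unless that term was already zero. -/
lemma excess_erase_le {S : Finset (Sym2 V)} {u w : V} (huw : u ≠ w) (h : s(u, w) ∈ S) :
    excess (S.erase s(u, w)) w + (if 2 ≤ edgeDegree S u then 1 else 0) ≤ excess S u := by
  have hd := edgeDegree_insert huw (Finset.notMem_erase s(u, w) S)
  rw [Finset.insert_erase h] at hd
  have hsum : ∑ v : V, (if v = u then (if 2 ≤ edgeDegree S u then 1 else 0) else 0)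
      = (if 2 ≤ edgeDegree S u then 1 else 0) := by
    rw [Finset.sum_ite_eq' Finset.univ u]
    simp
  rw [← hsum]
  unfold excess
  rw [← Finset.sum_add_distrib]
  refine Finset.sum_le_sum fun v _ => ?_
  have := hd v
  by_cases h1 : v = u
  · subst h1
    simp only [if_true, huw, if_false] at this ⊢
    split_ifs <;> omega
  · simp only [h1, if_false] at this ⊢
    split_ifs at * <;> omega

lemma excess_move_le (S : Finset (Sym2 V)) (u w : V) : excess S w ≤ excess S u + 1 := by
  have hsum : ∑ v : V, (if v = w then 1 else 0) = 1 := by simp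
  rw [← hsum]
  unfold excess
  rw [← Finset.sum_add_distrib]
  refine Finset.sum_le_sum fun v _ => ?_
  split_ifs <;> omega

lemma edgeDegree_le_card {Vis : Finset V} {S : Finset (Sym2 V)}
    (hS : ∀ e ∈ S, ∀ v ∈ e, v ∈ Vis) (u : V) : edgeDegree S u ≤ Vis.card :=
  Finset.card_le_card fun w hw => hS s(u, w) (by simpa using hw) w (by simp)

lemma edgeDegree_eq_zero {Vis : Finset V} {S : Finset (Sym2 V)}
    (hS : ∀ e ∈ S, ∀ v ∈ e, v ∈ Vis) {w : V} (hw : w ∉ Vis) : edgeDegree S w = 0 := by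
  refine Finset.card_eq_zero.2 (Finset.filter_eq_empty_iff.2 fun x _ hx => hw ?_)
  exact hS _ hx w (by simp)

/-- The three summands are the three kinds of step. In `k ^ 2 * K`, one `k` counts the visited
targets and the other pays for the growth of the potential. -/
lemma sum_stepWeight_mul_pow_excess_le {A B K : ℝ} (hA : 0 ≤ A) (hB : 0 ≤ B) (hK : 0 ≤ K)
    {Vis : Finset V} {S : Finset (Sym2 V)} (hS : ∀ e ∈ S, ∀ v ∈ e, v ∈ Vis)
    (hdiag : ∀ e ∈ S, ¬ e.IsDiag) {u : V} (hu : u ∈ Vis) {k : ℕ} (hk : 1 ≤ k)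
    (hcard : Vis.card ≤ k) :
    ∑ w, stepWeight A B K Vis S u w * (k : ℝ) ^ excess (nextEdges Vis S u w) w
      ≤ (Fintype.card V * A + B + k ^ 2 * K) * (k : ℝ) ^ excess S u := by
  have hk' : (1 : ℝ) ≤ k := by exact_mod_cast hk
  have hpow : (0 : ℝ) ≤ (k : ℝ) ^ excess S u := by positivity
  set Φ := (k : ℝ) ^ excess S u with hΦ
  have hterm : ∀ w, stepWeight A B K Vis S u w * (k : ℝ) ^ excess (nextEdges Vis S u w) w
      ≤ A * Φ + (if s(u, w) ∈ S then B * Φ / edgeDegree S u else 0)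
        + (if w ∈ Vis then K * (k * Φ) else 0) := by
    intro w
    have hi1 : (0 : ℝ) ≤ if s(u, w) ∈ S then B * Φ / edgeDegree S u else 0 := by
      split_ifs <;> positivity
    have hi2 : (0 : ℝ) ≤ if w ∈ Vis then K * (k * Φ) else 0 := by
      split_ifs <;> positivity
    have hi0 : 0 ≤ A * Φ := by positivity
    unfold stepWeight nextEdges
    by_cases hw : w ∉ Vis
    · rw [if_pos hw, if_pos hw]
      have h1 : excess (insert s(u, w) S) w ≤ excess S u :=
        excess_insert_le (fun h => hw (h ▸ hu)) (fun h => hw (hS _ h w (by simp)))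
          (edgeDegree_eq_zero hS hw)
      have : A * (k : ℝ) ^ excess (insert s(u, w) S) w ≤ A * Φ :=
        mul_le_mul_of_nonneg_left (pow_le_pow_right₀ hk' h1) hA
      linarith
    · rw [if_neg hw, if_neg hw]
      by_cases he : s(u, w) ∈ S
      · rw [if_pos he, if_pos he]
        rw [if_pos he] at hi1 ⊢
        have huw : u ≠ w := fun h => hdiag _ he (by simp [h])
        have h1 := excess_erase_le huw he
        have hpos : 0 < edgeDegree S u := Finset.card_pos.2 ⟨w, by simpa using he⟩
        have hD : (0 : ℝ) < edgeDegree S u := by exact_mod_cast hpos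
        have h3 : (k : ℝ) ^ excess (S.erase s(u, w)) w * edgeDegree S u ≤ Φ := by
          -- With two or more edges at `u`, the drop in excess frees a factor `k`, which covers
          -- their number; a single edge leaves nothing to pay for.
          by_cases h2 : 2 ≤ edgeDegree S u
          · rw [if_pos h2] at h1
            calc (k : ℝ) ^ excess (S.erase s(u, w)) w * edgeDegree S u
                ≤ (k : ℝ) ^ excess (S.erase s(u, w)) w * k := by
                  gcongr
                  exact (edgeDegree_le_card hS u).trans hcard
              _ = (k : ℝ) ^ (excess (S.erase s(u, w)) w + 1) := (pow_succ _ _).symm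
              _ ≤ Φ := pow_le_pow_right₀ hk' h1
          · have : edgeDegree S u = 1 := by omega
            rw [this, Nat.cast_one, mul_one]
            exact pow_le_pow_right₀ hk' (le_trans (Nat.le_add_right _ _) h1)
        have h4 : B * (k : ℝ) ^ excess (S.erase s(u, w)) w ≤ B * Φ / edgeDegree S u := by
          rw [le_div_iff₀ hD, mul_assoc]
          exact mul_le_mul_of_nonneg_left h3 hB
        linarith
      · rw [if_neg he, if_neg he]
        rw [if_pos (not_not.1 hw)] at hi2 ⊢
        have h1 : (k : ℝ) ^ excess S w ≤ k * Φ := by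
          rw [hΦ, mul_comm, ← pow_succ]
          exact pow_le_pow_right₀ hk' (excess_move_le S u w)
        have := mul_le_mul_of_nonneg_left h1 hK
        linarith
  refine (Finset.sum_le_sum fun w _ => hterm w).trans ?_
  rw [Finset.sum_add_distrib, Finset.sum_add_distrib, Finset.sum_const, ← Finset.sum_filter,
    ← Finset.sum_filter, Finset.sum_const, Finset.sum_const, Finset.card_univ]
  simp only [nsmul_eq_mul, Finset.filter_mem_eq_inter, Finset.univ_inter]
  have h1 : ((Finset.univ.filter fun w => s(u, w) ∈ S).card : ℝ) * (B * Φ / edgeDegree S u)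
      ≤ B * Φ := by
    change (edgeDegree S u : ℝ) * (B * Φ / edgeDegree S u) ≤ B * Φ
    rcases eq_or_ne (edgeDegree S u : ℝ) 0 with h | h
    · rw [h, zero_mul]; positivity
    · rw [mul_div_cancel₀ _ h]
  have h2 : (Vis.card : ℝ) * (K * (k * Φ)) ≤ k * (K * (k * Φ)) :=
    mul_le_mul_of_nonneg_right (by exact_mod_cast hcard) (by positivity)
  linarith

end Excess

/-! ### Weights dominating the moments along a walk -/

section Admissible

variable {V : Type*}

/-- The state of a walk: `Vis` is the set of visited vertices, `c` counts the traversals of each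
edge, `S` consists of edges traversed once, and `q` is a weight of each edge that dominates the
absolute moments `β e (c e)` of all edges outside `S`. -/
structure IsAdmissible (β : Sym2 V → ℕ → ℝ) (A : ℝ) (Vis : Finset V) (S : Finset (Sym2 V))
    (c : Sym2 V → ℕ) (q : Sym2 V → ℝ) : Prop where
  mem_of_ne_zero : ∀ e, c e ≠ 0 → ∀ v ∈ e, v ∈ Vis
  count_eq_one : ∀ e ∈ S, c e = 1
  le_weight : ∀ e ∈ S, A ≤ q e
  not_isDiag : ∀ e ∈ S, ¬ e.IsDiag
  moment_le : ∀ e ∉ S, β e (c e) ≤ q e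

lemma IsAdmissible.mem_vertices {β : Sym2 V → ℕ → ℝ} {A : ℝ} {Vis : Finset V}
    {S : Finset (Sym2 V)} {c : Sym2 V → ℕ} {q : Sym2 V → ℝ} (h : IsAdmissible β A Vis S c q) :
    ∀ e ∈ S, ∀ v ∈ e, v ∈ Vis :=
  fun e he => h.mem_of_ne_zero e (by rw [h.count_eq_one e he]; exact one_ne_zero)

/-- An edge in `S` needs no moment bound, only the deposit `A`: its second passage multiplies this
by `B`, which pays for the second moment. Each passage outside these two cases costs the uniform
bound `K`. -/
lemma IsAdmissible.step [DecidableEq V] {β : Sym2 V → ℕ → ℝ} {A B K : ℝ} (hA : 0 ≤ A) (hB : 0 ≤ B) (hK : 0 ≤ K)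
    (hβ0 : ∀ e, 1 ≤ β e 0) (hβ2 : ∀ e, β e 2 ≤ A * B) (hβK : ∀ e m, β e (m + 1) ≤ β e m * K)
    {Vis : Finset V} {S : Finset (Sym2 V)} {c : Sym2 V → ℕ} {q : Sym2 V → ℝ} {u : V}
    (hu : u ∈ Vis) (h : IsAdmissible β A Vis S c q) (w : V) :
    IsAdmissible β A (insert w Vis) (nextEdges Vis S u w) (c + Pi.single s(u, w) 1)
      (q * Pi.mulSingle s(u, w) (stepWeight A B K Vis S u w)) := by
  have hc : ∀ e, e ≠ s(u, w) → (c + Pi.single s(u, w) 1 : Sym2 V → ℕ) e = c e := fun e he => by simp [he]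
  have hq : ∀ t : ℝ, ∀ e, e ≠ s(u, w) → (q * Pi.mulSingle s(u, w) t : Sym2 V → ℝ) e = q e :=
    fun t e he => by simp [he]
  have hc' : (c + Pi.single s(u, w) 1 : Sym2 V → ℕ) s(u, w) = c s(u, w) + 1 := by simp
  have hq' : ∀ t : ℝ, (q * Pi.mulSingle s(u, w) t : Sym2 V → ℝ) s(u, w) = q s(u, w) * t := fun t => by simp
  have hmem : ∀ e, (c + Pi.single s(u, w) 1 : Sym2 V → ℕ) e ≠ 0 → ∀ v ∈ e, v ∈ insert w Vis := by
    intro e he v hv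
    by_cases hev : e = s(u, w)
    · subst hev
      rcases Sym2.mem_iff.1 hv with rfl | rfl
      · exact Finset.mem_insert_of_mem hu
      · exact Finset.mem_insert_self _ _
    · rw [hc e hev] at he
      exact Finset.mem_insert_of_mem (h.mem_of_ne_zero e he v hv)
  unfold nextEdges stepWeight
  by_cases hw : w ∉ Vis
  · rw [if_pos hw, if_pos hw]
    have hc0 : c s(u, w) = 0 := by
      by_contra h0
      exact hw (h.mem_of_ne_zero _ h0 w (by simp))
    have hnS : s(u, w) ∉ S := fun hS => hw (h.mem_vertices _ hS w (by simp))
    refine ⟨hmem, fun e he => ?_, fun e he => ?_, fun e he => ?_, fun e he => ?_⟩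
    · rcases eq_or_ne e s(u, w) with rfl | hne
      · rw [hc', hc0]
      · rw [hc e hne]
        exact h.count_eq_one e (Finset.mem_of_mem_insert_of_ne he hne)
    · rcases eq_or_ne e s(u, w) with rfl | hne
      · rw [hq']
        have := h.moment_le _ hnS
        rw [hc0] at this
        exact le_mul_of_one_le_left hA ((hβ0 _).trans this)
      · rw [hq _ e hne]
        exact h.le_weight e (Finset.mem_of_mem_insert_of_ne he hne)
    · rcases eq_or_ne e s(u, w) with rfl | hne
      · rw [Sym2.mk_isDiag_iff]
        rintro rfl
        exact hw hu
      · exact h.not_isDiag e (Finset.mem_of_mem_insert_of_ne he hne)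
    · have hne : e ≠ s(u, w) := fun h0 => he (h0 ▸ Finset.mem_insert_self _ _)
      rw [hc e hne, hq _ e hne]
      exact h.moment_le e fun h0 => he (Finset.mem_insert_of_mem h0)
  · rw [if_neg hw, if_neg hw]
    by_cases hS : s(u, w) ∈ S
    · rw [if_pos hS, if_pos hS]
      refine ⟨hmem, fun e he => ?_, fun e he => ?_, fun e he => ?_, fun e he => ?_⟩
      · rw [hc e (Finset.ne_of_mem_erase he)]
        exact h.count_eq_one e (Finset.mem_of_mem_erase he)
      · rw [hq _ e (Finset.ne_of_mem_erase he)]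
        exact h.le_weight e (Finset.mem_of_mem_erase he)
      · exact h.not_isDiag e (Finset.mem_of_mem_erase he)
      · rcases eq_or_ne e s(u, w) with rfl | hne
        · rw [hc', hq', h.count_eq_one _ hS]
          exact (hβ2 _).trans (mul_le_mul_of_nonneg_right (h.le_weight _ hS) hB)
        · rw [hc e hne, hq _ e hne]
          exact h.moment_le e fun h0 => he (Finset.mem_erase_of_ne_of_mem hne h0)
    · rw [if_neg hS, if_neg hS]
      refine ⟨hmem, fun e he => ?_, fun e he => ?_, h.not_isDiag, fun e he => ?_⟩
      · rw [hc e fun h0 => hS (h0 ▸ he)]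
        exact h.count_eq_one e he
      · rw [hq _ e fun h0 => hS (h0 ▸ he)]
        exact h.le_weight e he
      · rcases eq_or_ne e s(u, w) with rfl | hne
        · rw [hc', hq']
          exact (hβK _ _).trans (mul_le_mul_of_nonneg_right (h.moment_le _ hS) hK)
        · rw [hc e hne, hq _ e hne]
          exact h.moment_le e he

lemma prod_mul_mulSingle {ι : Type*} [Fintype ι] [DecidableEq ι] (q : ι → ℝ) (e : ι) (t : ℝ) :
    ∏ i, (q * Pi.mulSingle e t : ι → ℝ) i = (∏ i, q i) * t := by
  simp only [Pi.mul_apply, Finset.prod_mul_distrib]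
  congr 1
  rw [Finset.prod_eq_single e (fun b _ hb => by simp [hb]) (by simp)]
  simp

end Admissible

/-! ### Spectral norm and trace -/

section SpectralNorm

lemma IsSelfAdjoint.norm_pow_eq {E : Type*} [NormedRing E] [StarRing E] [CStarRing E]
    [NormOneClass E] {x : E} (hx : IsSelfAdjoint x) (p : ℕ) : ‖x ^ p‖ = ‖x‖ ^ p := by
  refine le_antisymm (norm_pow_le x p) ?_
  rcases (norm_nonneg x).eq_or_lt with h | h
  · rw [norm_eq_zero.1 h.symm]
    rcases eq_or_ne p 0 with rfl | hp
    · simp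
    · simp [hp]
  · have h1 := hx.norm_pow_two_pow p
    have h2 : p ≤ 2 ^ p := Nat.lt_two_pow_self.le
    -- Equality is known for the exponent `2 ^ p = p + d`; a strict loss at `p` would persist there
    -- by submultiplicativity.
    obtain ⟨d, hd⟩ := Nat.exists_eq_add_of_le h2
    rw [hd, pow_add, pow_add] at h1
    have h3 : ‖x‖ ^ p * ‖x‖ ^ d ≤ ‖x ^ p‖ * ‖x‖ ^ d :=
      h1 ▸ (norm_mul_le _ _).trans (mul_le_mul_of_nonneg_left (norm_pow_le x d) (norm_nonneg _))
    exact le_of_mul_le_mul_right h3 (pow_pos h d)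

lemma norm_toEuclideanCLM_sq_le {ι : Type*} [Fintype ι] [DecidableEq ι] (M : Matrix ι ι ℝ) :
    ‖Matrix.toEuclideanCLM (n := ι) (𝕜 := ℝ) M‖ ^ 2 ≤ ∑ i, ∑ j, M i j ^ 2 := by
  have h0 : 0 ≤ ∑ i, ∑ j, M i j ^ 2 := by positivity
  have h1 : ‖Matrix.toEuclideanCLM (n := ι) (𝕜 := ℝ) M‖ ≤ √(∑ i, ∑ j, M i j ^ 2) := by
    refine ContinuousLinearMap.opNorm_le_bound _ (Real.sqrt_nonneg _) fun x => ?_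
    rw [EuclideanSpace.norm_eq, EuclideanSpace.norm_eq, ← Real.sqrt_mul h0]
    refine Real.sqrt_le_sqrt ?_
    rw [Finset.sum_mul]
    refine Finset.sum_le_sum fun i _ => ?_
    simp only [Real.norm_eq_abs, sq_abs]
    rw [Matrix.ofLp_toEuclideanCLM]
    exact Finset.sum_mul_sq_le_sq_mul_sq _ _ _
  calc _ ≤ (√(∑ i, ∑ j, M i j ^ 2)) ^ 2 := by gcongr
    _ = _ := Real.sq_sqrt h0

/-- By symmetry, `tr (M ^ (2 * p))` is the squared Frobenius norm of `M ^ p`, which dominates its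
squared operator norm. -/
lemma spectralNorm₂_pow_le_trace {n : ℕ} [NeZero n] {M : Matrix (Fin n) (Fin n) ℝ}
    (hM : M.IsSymm) (p : ℕ) : spectralNorm₂ M ^ (2 * p) ≤ (M ^ (2 * p)).trace := by
  have hstar : star M = M := by
    rw [Matrix.star_eq_conjTranspose, Matrix.conjTranspose_eq_transpose_of_trivial]
    exact hM
  have hself : IsSelfAdjoint (Matrix.toEuclideanCLM (n := Fin n) (𝕜 := ℝ) M) := by
    rw [IsSelfAdjoint, ← map_star, hstar]
  have hpow : (M ^ p).IsSymm := hM.pow p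
  calc spectralNorm₂ M ^ (2 * p)
      = ‖Matrix.toEuclideanCLM (n := Fin n) (𝕜 := ℝ) (M ^ p)‖ ^ 2 := by
        rw [map_pow, hself.norm_pow_eq, mul_comm, pow_mul, spectralNorm₂]
    _ ≤ ∑ i, ∑ j, (M ^ p) i j ^ 2 := norm_toEuclideanCLM_sq_le _
    _ = (M ^ (2 * p)).trace := by
        rw [two_mul, pow_add, Matrix.trace]
        refine Finset.sum_congr rfl fun i _ => ?_
        rw [Matrix.diag_apply, Matrix.mul_apply]
        refine Finset.sum_congr rfl fun j _ => ?_
        rw [sq, hpow.apply i j]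

end SpectralNorm

/-! ### Expected trace of a power -/

section Moments

variable {V Ω : Type*} [Fintype V] [DecidableEq V] [MeasurableSpace Ω]

/-- The symmetric matrix with the entry `x e` at both places of the edge `e`. -/
def edgeMatrix (x : Sym2 V → ℝ) : Matrix V V ℝ := Matrix.of fun u w => x s(u, w)

lemma memLp_top_prod {ι : Type*} {P : Measure Ω} [IsFiniteMeasure P] {f : ι → Ω → ℝ} (s : Finset ι)
    (hf : ∀ i ∈ s, MemLp (f i) ⊤ P) : MemLp (fun ω => ∏ i ∈ s, f i ω) ⊤ P := by
  classical
  induction s using Finset.induction_on with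
  | empty => simpa using memLp_const (1 : ℝ)
  | insert a s ha ih =>
    simp only [Finset.prod_insert ha]
    exact (ih fun i hi => hf i (Finset.mem_insert_of_mem hi)).mul
      (hf a (Finset.mem_insert_self a s))

lemma memLp_top_pow {P : Measure Ω} [IsFiniteMeasure P] {f : Ω → ℝ} (hf : MemLp f ⊤ P) (m : ℕ) :
    MemLp (fun ω => f ω ^ m) ⊤ P := by
  simpa using memLp_top_prod (f := fun _ : ℕ => f) (Finset.range m) fun _ _ => hf

lemma memLp_top_edgeMatrix_pow {P : Measure Ω} [IsFiniteMeasure P] {Y : Sym2 V → Ω → ℝ}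
    (hY : ∀ e, MemLp (Y e) ⊤ P) (j : ℕ) (u v : V) :
    MemLp (fun ω => (edgeMatrix (fun e => Y e ω) ^ j) u v) ⊤ P := by
  induction j generalizing u with
  | zero => simpa using memLp_const _
  | succ j ih =>
    simp only [pow_succ', Matrix.mul_apply]
    exact memLp_finsetSum _ fun w _ => (ih w).mul (hY s(u, w))

variable {P : Measure Ω} [IsProbabilityMeasure P] {Y : Sym2 V → Ω → ℝ}

lemma abs_integral_prod_le_prod_weight {A : ℝ} (hA : 0 ≤ A) (hLp : ∀ e, MemLp (Y e) ⊤ P)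
    (hind : iIndepFun Y P) (hmean : ∀ e, ∫ ω, Y e ω ∂P = 0)
    {Vis : Finset V} {S : Finset (Sym2 V)} {c : Sym2 V → ℕ} {q : Sym2 V → ℝ}
    (h : IsAdmissible (fun e m => ∫ ω, |Y e ω| ^ m ∂P) A Vis S c q) :
    |∫ ω, ∏ e, Y e ω ^ c e ∂P| ≤ ∏ e, q e := by
  have hprod : ∫ ω, ∏ e, Y e ω ^ c e ∂P = ∏ e, ∫ ω, Y e ω ^ c e ∂P :=
    (hind.comp (fun e x => x ^ c e)
      fun e => measurable_id.pow_const _).integral_fun_prod_eq_prod_integral fun e => (memLp_top_pow (hLp e) (c e)).1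
  rw [hprod]
  rcases S.eq_empty_or_nonempty with rfl | ⟨e₀, he₀⟩
  · rw [Finset.abs_prod]
    refine Finset.prod_le_prod (fun _ _ => abs_nonneg _) fun e _ => ?_
    refine le_trans ?_ (h.moment_le e (Finset.notMem_empty e))
    simpa only [abs_pow] using abs_integral_le_integral_abs (f := fun ω => Y e ω ^ c e) (μ := P)
  -- An edge left in `S` has exponent one, so its factor is a vanishing mean.
  · rw [Finset.prod_eq_zero (Finset.mem_univ e₀)
      (by simpa [h.count_eq_one e₀ he₀] using hmean e₀), abs_zero]
    refine Finset.prod_nonneg fun e _ => ?_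
    by_cases he : e ∈ S
    · exact hA.trans (h.le_weight e he)
    · exact (integral_nonneg fun ω => by positivity).trans (h.moment_le e he)

/-- Induction on the number `j` of remaining steps, with the past of the walk stored in `c`. A step
adds at most one vertex, so `Vis.card + j ≤ k + 1` persists and ensures `Vis.card ≤ k` whenever a
step remains. -/
lemma abs_integral_prod_mul_pow_apply_le {A B K : ℝ} (hA : 0 ≤ A) (hB : 0 ≤ B) (hK : 0 ≤ K)
    (hmeas : ∀ e, Measurable (Y e)) (hind : iIndepFun Y P) (hmean : ∀ e, ∫ ω, Y e ω ∂P = 0)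
    (hbdd : ∀ e, ∀ᵐ ω ∂P, |Y e ω| ≤ K) (hvar : ∀ e, ∫ ω, Y e ω ^ 2 ∂P ≤ A * B)
    {k : ℕ} (hk : 1 ≤ k) (v : V) (j : ℕ) :
    ∀ {u : V} {Vis : Finset V} {S : Finset (Sym2 V)} {c : Sym2 V → ℕ} {q : Sym2 V → ℝ},
      u ∈ Vis → Vis.card + j ≤ k + 1 →
      IsAdmissible (fun e m => ∫ ω, |Y e ω| ^ m ∂P) A Vis S c q →
      |∫ ω, (∏ e, Y e ω ^ c e) * (edgeMatrix (fun e => Y e ω) ^ j) u v ∂P|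
        ≤ (∏ e, q e) * (Fintype.card V * A + B + k ^ 2 * K) ^ j * (k : ℝ) ^ excess S u := by
  have hLp : ∀ e, MemLp (Y e) ⊤ P := fun e =>
    memLp_top_of_bound (hmeas e).aestronglyMeasurable K (hbdd e)
  have hk' : (1 : ℝ) ≤ k := by exact_mod_cast hk
  induction j with
  | zero =>
    intro u Vis S c q _ _ h
    have h1 := abs_integral_prod_le_prod_weight hA hLp hind hmean h
    have h2 : (0 : ℝ) ≤ ∏ e, q e := (abs_nonneg _).trans h1
    rw [pow_zero, mul_one]
    refine le_trans ?_ (le_mul_of_one_le_right h2 (one_le_pow₀ hk'))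
    simp only [pow_zero, integral_mul_const, abs_mul]
    refine le_trans (mul_le_of_le_one_right (abs_nonneg _) ?_) h1
    rw [Matrix.one_apply]
    split_ifs <;> simp
  | succ j ih =>
    intro u Vis S c q hu hcard h
    have hq : (0 : ℝ) ≤ ∏ e, q e :=
      (abs_nonneg _).trans (abs_integral_prod_le_prod_weight hA hLp hind hmean h)
    have hexpand : ∀ ω, (∏ e, Y e ω ^ c e) * (edgeMatrix (fun e => Y e ω) ^ (j + 1)) u v
        = ∑ w, (∏ e, Y e ω ^ (c + Pi.single s(u, w) 1 : Sym2 V → ℕ) e)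
            * (edgeMatrix (fun e => Y e ω) ^ j) w v := by
      intro ω
      rw [pow_succ', Matrix.mul_apply, Finset.mul_sum]
      refine Finset.sum_congr rfl fun w _ => ?_
      rw [← mul_assoc]
      congr 1
      simp only [Pi.add_apply, pow_add, Finset.prod_mul_distrib]
      congr 1
      rw [Finset.prod_eq_single s(u, w) (fun e _ he => by simp [he]) (by simp)]
      simp [edgeMatrix]
    have hint : ∀ w, Integrable (fun ω =>
        (∏ e, Y e ω ^ (c + Pi.single s(u, w) 1 : Sym2 V → ℕ) e)
          * (edgeMatrix (fun e => Y e ω) ^ j) w v) P := fun w =>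
      ((memLp_top_edgeMatrix_pow hLp j w v).mul
        (memLp_top_prod Finset.univ fun e _ => memLp_top_pow (hLp e) _)).integrable le_top
    have hstep : ∀ w, |∫ ω, (∏ e, Y e ω ^ (c + Pi.single s(u, w) 1 : Sym2 V → ℕ) e)
          * (edgeMatrix (fun e => Y e ω) ^ j) w v ∂P|
        ≤ ((∏ e, q e) * (Fintype.card V * A + B + k ^ 2 * K) ^ j)
          * (stepWeight A B K Vis S u w * (k : ℝ) ^ excess (nextEdges Vis S u w) w) := by
      intro w
      have hadm := h.step (B := B) (K := K) hA hB hK (fun e => by simp)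
        (fun e => by simpa only [sq_abs] using hvar e)
        (fun e m => by
          have hm : MemLp (fun ω => |Y e ω| ^ m) ⊤ P := memLp_top_pow (hLp e).norm m
          have hm' : MemLp (fun ω => |Y e ω| ^ (m + 1)) ⊤ P := memLp_top_pow (hLp e).norm (m + 1)
          rw [← integral_mul_const]
          refine integral_mono_ae (hm'.integrable le_top) ((hm.integrable le_top).mul_const K) ?_
          filter_upwards [hbdd e] with ω hω
          rw [pow_succ]
          gcongr) hu w
      have := ih (Finset.mem_insert_self w Vis)
        (by have := Finset.card_insert_le w Vis; omega) hadm
      rw [prod_mul_mulSingle] at this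
      linarith
    simp only [hexpand]
    rw [integral_finsetSum _ fun w _ => hint w]
    refine (Finset.abs_sum_le_sum_abs _ _).trans ((Finset.sum_le_sum fun w _ => hstep w).trans ?_)
    rw [← Finset.mul_sum]
    refine (mul_le_mul_of_nonneg_left (sum_stepWeight_mul_pow_excess_le hA hB hK h.mem_vertices
      h.not_isDiag hu hk (by omega)) (by positivity)).trans_eq ?_
    rw [pow_succ _ j]
    ring

theorem integral_trace_pow_le {A B K : ℝ} (hA : 0 ≤ A) (hB : 0 ≤ B) (hK : 0 ≤ K)
    (hmeas : ∀ e, Measurable (Y e)) (hind : iIndepFun Y P) (hmean : ∀ e, ∫ ω, Y e ω ∂P = 0)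
    (hbdd : ∀ e, ∀ᵐ ω ∂P, |Y e ω| ≤ K) (hvar : ∀ e, ∫ ω, Y e ω ^ 2 ∂P ≤ A * B)
    {k : ℕ} (hk : 1 ≤ k) :
    Integrable (fun ω => (edgeMatrix (fun e => Y e ω) ^ k).trace) P ∧
    ∫ ω, (edgeMatrix (fun e => Y e ω) ^ k).trace ∂P
      ≤ Fintype.card V * (Fintype.card V * A + B + k ^ 2 * K) ^ k := by
  have hint : ∀ u : V, Integrable (fun ω => (edgeMatrix (fun e => Y e ω) ^ k) u u) P := fun u =>
    (memLp_top_edgeMatrix_pow (fun e =>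
      memLp_top_of_bound (hmeas e).aestronglyMeasurable K (hbdd e)) k u u).integrable le_top
  refine ⟨integrable_finsetSum _ fun u _ => hint u, ?_⟩
  have hu : ∀ u : V, ∫ ω, (edgeMatrix (fun e => Y e ω) ^ k) u u ∂P
      ≤ (Fintype.card V * A + B + k ^ 2 * K) ^ k := by
    intro u
    have h0 : excess (∅ : Finset (Sym2 V)) u = 0 :=
      Finset.sum_eq_zero fun v _ => by
        simp only [edgeDegree, Finset.notMem_empty, Finset.filter_false, Finset.card_empty]
        split_ifs <;> rfl
    have := abs_integral_prod_mul_pow_apply_le hA hB hK hmeas hind hmean hbdd hvar hk u k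
      (u := u) (Vis := {u}) (S := ∅) (c := 0) (q := 1) (Finset.mem_singleton_self u)
      (by simp [add_comm]) ⟨by simp, by simp, by simp, by simp, by simp⟩
    simp only [Pi.zero_apply, pow_zero, Finset.prod_const_one, one_mul, Pi.one_apply, h0,
      mul_one] at this
    exact (le_abs_self _).trans this
  simp only [Matrix.trace, Matrix.diag_apply]
  rw [integral_finsetSum _ fun u _ => hint u]
  refine (Finset.sum_le_sum fun u _ => hu u).trans ?_
  simp

end Moments

/-! ### Choice of the exponent and conclusion -/

section Main

open Filter Topology

lemma exp_half_le_one_add {y : ℝ} (h0 : 0 ≤ y) (h1 : y ≤ 1) : Real.exp (y / 2) ≤ 1 + y := by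
  have h2 : 1 - y / 2 ≤ Real.exp (-(y / 2)) := by
    linarith [Real.add_one_le_exp (-(y / 2))]
  have h3 : Real.exp (y / 2) * Real.exp (-(y / 2)) = 1 := by rw [← Real.exp_add]; simp
  have h4 : Real.exp (y / 2) * (1 - y / 2) ≤ 1 :=
    (mul_le_mul_of_nonneg_left h2 (Real.exp_pos _).le).trans_eq h3
  have h5 : 1 ≤ (1 + y) * (1 - y / 2) := by nlinarith
  exact le_of_mul_le_mul_right (h4.trans h5) (by linarith)

lemma eventually_exists_exponent {K σ : ℝ} (hK : 0 < K) (hσ : 0 < σ) :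
    ∀ᶠ n : ℕ in atTop, 0 < n ∧ ∃ p : ℕ, 1 ≤ p ∧
      (n : ℝ) * (2 * σ * √(n : ℝ) + ((2 * p : ℕ) : ℝ) ^ 2 * K) ^ (2 * p) * (n : ℝ) ^ 10
        < (2 * σ * √(n : ℝ) + 50 * K * (n : ℝ) ^ (1 / 3 : ℝ) * Real.log n) ^ (2 * p) := by
  have hcast : Tendsto (fun n : ℕ => (n : ℝ)) atTop atTop := tendsto_natCast_atTop_atTop
  have hlog : ∀ᶠ n : ℕ in atTop, 16 * (σ / K) ^ 2 ≤ Real.log n :=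
    (Real.tendsto_log_atTop.comp hcast).eventually_ge_atTop _
  have hroot : ∀ᶠ n : ℕ in atTop, K / σ ≤ (n : ℝ) ^ (1 / 6 : ℝ) :=
    ((tendsto_rpow_atTop (by norm_num)).comp hcast).eventually_ge_atTop _
  have hlo : ∀ᶠ n : ℕ in atTop,
      ‖Real.log n‖ ≤ σ / (16 * K) * ‖(n : ℝ) ^ (1 / 6 : ℝ)‖ :=
    hcast.eventually ((isLittleO_log_rpow_atTop (r := 1 / 6) (by norm_num)).bound (by positivity))
  filter_upwards [hlog, hroot, hlo, eventually_ge_atTop 2] with n h1 h2 h3 hn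
  have hn' : (2 : ℝ) ≤ n := by exact_mod_cast hn
  have hn0 : (0 : ℝ) < n := by linarith
  set L := Real.log n with hL
  set a := (n : ℝ) ^ (1 / 6 : ℝ) with ha
  have hL0 : 0 < L := Real.log_pos (by linarith)
  have ha0 : 0 < a := Real.rpow_pos_of_pos hn0 _
  have ha3 : √(n : ℝ) = a ^ 3 := by
    rw [Real.sqrt_eq_rpow, ha, ← Real.rpow_natCast, ← Real.rpow_mul hn0.le]
    norm_num
  have ha2 : (n : ℝ) ^ (1 / 3 : ℝ) = a ^ 2 := by
    rw [ha, ← Real.rpow_natCast, ← Real.rpow_mul hn0.le]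
    norm_num
  rw [Real.norm_of_nonneg hL0.le, Real.norm_of_nonneg ha0.le] at h3
  set C := σ / K with hC
  have hC0 : 0 < C := by positivity
  have hσC : σ = C * K := by rw [hC]; field_simp
  have hCa : 1 ≤ C * a := by
    rw [div_le_iff₀ hσ] at h2
    rw [hC, div_mul_eq_mul_div, one_le_div hK]
    linarith
  have h16 : 16 * L ≤ C * a := by
    have : σ / (16 * K) = C / 16 := by rw [hC]; field_simp
    rw [this] at h3
    linarith
  -- With `p` about `(σ / K) * n ^ (1/6)`, `(2 * p) ^ 2 * K` is of order `n ^ (1/3)`, so `log n`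
  -- eventually absorbs its constant.
  refine ⟨by omega, ⌈C * a⌉₊, Nat.one_le_ceil_iff.2 (by positivity), ?_⟩
  set p := ⌈C * a⌉₊ with hp
  have hp1 : C * a ≤ p := Nat.le_ceil _
  have hp2 : (p : ℝ) ≤ 2 * (C * a) := by
    have := Nat.ceil_lt_add_one (a := C * a) (by positivity)
    linarith
  rw [ha3, ha2]
  set l := 2 * σ * a ^ 3 + K * a ^ 2 * L with hl
  have hl0 : 0 < l := by positivity
  have hle : 2 * σ * a ^ 3 + ((2 * p : ℕ) : ℝ) ^ 2 * K ≤ l := by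
    have h4 : ((2 * p : ℕ) : ℝ) ^ 2 ≤ (4 * (C * a)) ^ 2 := by
      refine pow_le_pow_left₀ (Nat.cast_nonneg _) ?_ 2
      push_cast
      linarith
    have h5 : (4 * (C * a)) ^ 2 ≤ a ^ 2 * L := by
      have := mul_le_mul_of_nonneg_left h1 (sq_nonneg a)
      linarith
    have := mul_le_mul_of_nonneg_right (h4.trans h5) hK.le
    linarith
  set y := 16 * L / (C * a) with hy
  have hy0 : 0 ≤ y := by positivity
  have hy1 : y ≤ 1 := (div_le_one (by positivity)).2 h16
  have hya : y * (C * a) = 16 * L := by rw [hy]; field_simp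
  -- Of the constant 50, one unit is already in `l` and 48 come from `l * y`.
  have hT : l * (1 + y) ≤ 2 * σ * a ^ 3 + 50 * K * a ^ 2 * L := by
    have h4 : l ≤ 3 * σ * a ^ 3 := by
      have : K * a ^ 2 * L ≤ K * a ^ 2 * (C * a) := by gcongr; linarith
      rw [hl, hσC]
      linarith
    have h5 : l * y ≤ 48 * K * a ^ 2 * L := by
      calc l * y ≤ 3 * σ * a ^ 3 * y := by gcongr
        _ = 3 * K * a ^ 2 * (y * (C * a)) := by rw [hσC]; ring
        _ = 48 * K * a ^ 2 * L := by rw [hya]; ring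
    have : 0 ≤ K * a ^ 2 * L := by positivity
    linarith
  -- Only `n ^ 11` has to be beaten: `n` from the trace and `n ^ 10` from the target probability.
  have hbig : (n : ℝ) ^ 16 ≤ (1 + y) ^ (2 * p) := by
    calc (n : ℝ) ^ 16 = Real.exp (16 * L) := by
          rw [hL, mul_comm, Real.exp_mul, Real.exp_log hn0]
          exact_mod_cast rfl
      _ ≤ Real.exp (((2 * p : ℕ) : ℝ) * (y / 2)) := by
          rw [← hya]
          refine Real.exp_le_exp.2 ?_
          push_cast
          linarith [mul_le_mul_of_nonneg_left hp1 hy0]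
      _ = Real.exp (y / 2) ^ (2 * p) := Real.exp_nat_mul _ _
      _ ≤ (1 + y) ^ (2 * p) := by
          gcongr
          exact exp_half_le_one_add hy0 hy1
  calc (n : ℝ) * (2 * σ * a ^ 3 + ((2 * p : ℕ) : ℝ) ^ 2 * K) ^ (2 * p) * (n : ℝ) ^ 10
      ≤ (n : ℝ) * l ^ (2 * p) * (n : ℝ) ^ 10 := by gcongr
    _ = l ^ (2 * p) * (n : ℝ) ^ 11 := by ring
    _ < l ^ (2 * p) * (n : ℝ) ^ 16 := by
        gcongr
        · linarith
        · norm_num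
    _ ≤ l ^ (2 * p) * (1 + y) ^ (2 * p) := by gcongr
    _ = (l * (1 + y)) ^ (2 * p) := (mul_pow _ _ _).symm
    _ ≤ _ := by gcongr

end Main

theorem theoremA1 (K σ : ℝ) (hK : 0 < K) (hσ : 0 < σ) :
    ∃ n₀ : ℕ, ∀ n : ℕ, n₀ < n →
      ∀ (Ω : Type*) [MeasurableSpace Ω] (P : Measure Ω) [IsProbabilityMeasure P]
        (X : Ω → Matrix (Fin n) (Fin n) ℝ),
        (∀ ω, (X ω).IsSymm) →
        (∀ i j, i ≤ j → Measurable fun ω => X ω i j) →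
        iIndepFun (fun (p : {p : Fin n × Fin n // p.1 ≤ p.2}) ω => X ω p.1.1 p.1.2) P →
        (∀ i j, i ≤ j → ∫ ω, X ω i j ∂P = 0) →
        (∀ i j, i ≤ j → ∀ᵐ ω ∂P, |X ω i j| ≤ K) →
        (∀ i j, i ≤ j → ∫ ω, X ω i j ^ 2 ∂P ≤ σ ^ 2) →
        P.real {ω | 2 * σ * √(n : ℝ) + 50 * K * (n : ℝ) ^ (1 / 3 : ℝ) * Real.log n
            < spectralNorm₂ (X ω)}
          < 1 / (n : ℝ) ^ 10 := by
  obtain ⟨n₀, hn₀⟩ := Filter.eventually_atTop.1 (eventually_exists_exponent hK hσ)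
  refine ⟨n₀, fun n hn Ω _ P _ X hsymm hmeas hind hmean hbdd hvar => ?_⟩
  obtain ⟨hnpos, p, hp, hlt⟩ := hn₀ n hn.le
  have : NeZero n := ⟨hnpos.ne'⟩
  have hn' : (0 : ℝ) < n := by exact_mod_cast hnpos
  have hsqrt : (0 : ℝ) < √(n : ℝ) := Real.sqrt_pos.2 hn'
  set T := 2 * σ * √(n : ℝ) + 50 * K * (n : ℝ) ^ (1 / 3 : ℝ) * Real.log n with hT
  set k := 2 * p with hk
  have hT0 : 0 < T := by
    have : 0 ≤ Real.log n := Real.log_natCast_nonneg n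
    positivity
  let Y : Sym2 (Fin n) → Ω → ℝ := fun e ω => X ω (Sym2.sortEquiv e).1.1 (Sym2.sortEquiv e).1.2
  have hY : ∀ ω, edgeMatrix (fun e => Y e ω) = X ω := by
    intro ω
    ext u w
    rcases le_total u w with h | h
    · simp [edgeMatrix, Y, Sym2.sortEquiv, h]
    · simp [edgeMatrix, Y, Sym2.sortEquiv, h, (hsymm ω).apply]
  -- This choice makes `n * A` equal to `B`, which minimises `n * A + B` for the given product `A *
  -- B`.
  have hAB : σ / √(n : ℝ) * (σ * √(n : ℝ)) = σ ^ 2 := by field_simp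
  have hAn : (n : ℝ) * (σ / √(n : ℝ)) = σ * √(n : ℝ) := by
    rw [mul_div_assoc', div_eq_iff hsqrt.ne', mul_assoc, Real.mul_self_sqrt hn'.le, mul_comm]
  obtain ⟨hint, htrace⟩ := integral_trace_pow_le (P := P) (Y := Y) (A := σ / √(n : ℝ))
    (B := σ * √(n : ℝ)) (K := K) (k := k) (by positivity) (by positivity) hK.le
    (fun e => hmeas _ _ (Sym2.sortEquiv e).2)
    (hind.precomp Sym2.sortEquiv.injective)
    (fun e => hmean _ _ (Sym2.sortEquiv e).2) (fun e => hbdd _ _ (Sym2.sortEquiv e).2)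
    (fun e => (hvar _ _ (Sym2.sortEquiv e).2).trans_eq hAB.symm) (by omega)
  simp only [hY, Fintype.card_fin, hAn] at hint htrace
  have hle : ∀ ω, spectralNorm₂ (X ω) ^ k ≤ (X ω ^ k).trace := fun ω =>
    spectralNorm₂_pow_le_trace (hsymm ω) p
  have hmarkov := mul_meas_ge_le_integral_of_nonneg (μ := P) (ae_of_all _ fun ω =>
    (pow_nonneg (norm_nonneg _) k).trans (hle ω)) hint (T ^ k)
  have hmono : P.real {ω | T < spectralNorm₂ (X ω)} ≤ P.real {ω | T ^ k ≤ (X ω ^ k).trace} :=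
    measureReal_mono fun ω (hω : T < _) => (pow_le_pow_left₀ hT0.le hω.le k).trans (hle ω)
  rw [lt_div_iff₀ (by positivity)]
  have hTk : 0 < T ^ k := by positivity
  refine lt_of_mul_lt_mul_left ?_ hTk.le
  calc T ^ k * (P.real {ω | T < spectralNorm₂ (X ω)} * (n : ℝ) ^ 10)
      = T ^ k * P.real {ω | T < spectralNorm₂ (X ω)} * (n : ℝ) ^ 10 := by ring
    _ ≤ T ^ k * P.real {ω | T ^ k ≤ (X ω ^ k).trace} * (n : ℝ) ^ 10 := by gcongr
    _ ≤ (n : ℝ) * (2 * σ * √(n : ℝ) + (k : ℝ) ^ 2 * K) ^ k * (n : ℝ) ^ 10 := by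
        refine mul_le_mul_of_nonneg_right (hmarkov.trans (htrace.trans_eq ?_)) (by positivity)
        ring
    _ < T ^ k := hlt
    _ = T ^ k * 1 := (mul_one _).symm
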